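/- Let $k\ge 0$ and $n\ge 1$ be integers, let $0<p_1<\dots<p_k<1$, put $p_0=0$, $p_{k+1}=1$ and $\Delta p_j=p_j-p_{j-1}$ for $1\le j\le k+1$. For $\theta\in\mathbb R^k$ put $S_j(\theta)=(\theta_{j-1},\theta_j]$ for $1\le j\le k+1$, with $\theta_0=-\infty$ and $\theta_{k+1}=\infty$. Let $y_1,\dots,y_n\in\mathbb R$ (ties allowed) have empirical distribution $F_n=\frac1n\sum_{i=1}^n\delta_{y_i}$, and let $\pi$ be a (measurable, nonnegative) probability density on $\mathbb R^k$ that vanishes outside $\{\theta_1\le\dots\le\theta_k\}$. In the quantile model $\theta$ has prior density $\pi$, $F$ given $\theta$ is a Dirichlet process with base measure $\alpha$ conditioned on $g(F,\theta)=(F(S_1(\theta)),\dots,F(S_{k+1}(\theta)))=\Delta p$, and the observations are i.i.d. from $F$. The posterior density of the quantiles is $$\pi(\theta\mid \mathbf y_n)=\frac{w_A(\theta)}{\int w_A},\qquad w_A(\theta)=\frac{h(\Delta p:g(F,\theta),\alpha+nF_n)}{h(\Delta p:g(F,\theta),\alpha)}\,\pi(\theta),$$ where $h(\cdot:g(F,\theta),\alpha)$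 is the density of $g(F,\theta)$ under the Dirichlet process, that is, the Dirichlet density with parameters $\alpha(S_1(\theta)),\dots,\alpha(S_{k+1}(\theta))$. Take $\alpha=A\,F_n$ with $A>0$. Then the ratio of densities is a function of the cell probabilities $q_j=F_n(S_j(\theta))$, namely $h_{(A+n)q}(\Delta p)/h_{Aq}(\Delta p)$ with $h_a(x)=\frac{\Gamma(\sum_j a_j)}{\prod_j\Gamma(a_j)}\prod_j x_j^{a_j-1}$. If some $q_j=0$, so that this formula contains the undefined quotient $\Gamma(0)/\Gamma(0)$, the ratio is understood as its continuous extension, in $q$, from vectors with all $q_j>0$. Then the following hold. 1. For every $A>0$, with $\bar\alpha=\alpha/\alpha(\mathbb R)$ and $\boldsymbol J=\{j: F_n(S_j(\theta))>0\}$, the function $$G(\theta)=\frac{\Gamma(n+1)}{\prod_{j\in \boldsymbol J}\bar\alpha(S_j(\theta))\,\Gamma(nF_n(S_j(\theta)))}\prod_{j=1}^{k+1}(\Delta p_j)^{nF_n(S_j(\theta))}\,\pi(\theta)$$ is integrable on $\mathbb R^k$. 2. For every $A>0$ the function $w_A$ is integrable with $\int w_A>0$, so that the posterior density is well defined. 3.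 The number $$z_*=\int \frac{1}{\prod_{j=1}^{k+1}(nF_n(S_j(\theta)))!}\prod_{j=1}^{k+1}(\Delta p_j)^{nF_n(S_j(\theta))}\,\pi(\theta)\,d\theta$$ is finite and positive and, as $A\to0^+$, for every $\theta\in\mathbb R^k$, $$\pi(\theta\mid\mathbf y_n)\longrightarrow \frac{1}{z_*\prod_{j=1}^{k+1}(nF_n(S_j(\theta)))!}\prod_{j=1}^{k+1}(\Delta p_j)^{nF_n(S_j(\theta))}\,\pi(\theta).$$ -/

import Mathlib

open MeasureTheory Filter Topology
open scoped Nat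

noncomputable section

/-- The cell `S_j(θ) = (θ_{j-1}, θ_j]` of the line cut at `θ₁ ≤ … ≤ θ_k`, where `θ₀ = -∞` and
`θ_{k+1} = ∞`. The cells are numbered `0, …, k` and the entries of `θ` are numbered `0, …, k - 1`,
so cell `j` is bounded below by the entry `i` with `i + 1 = j` and above by the entry `j`,
whenever these exist. -/
def quantileCell {k : ℕ} (θ : Fin k → ℝ) (j : Fin (k + 1)) : Set ℝ :=
  {t | (∀ i : Fin k, i.succ = j → θ i < t) ∧ (∀ i : Fin k, i.castSucc = j → t ≤ θ i)}

/-- The increments `Δp_j = p_j - p_{j-1}` for `j = 1, …, k + 1`, where `p₀ = 0`, `p_{k+1} = 1`. -/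
def levelIncrement {k : ℕ} (p : Fin k → ℝ) (j : Fin (k + 1)) : ℝ :=
  (Fin.snoc p 1 : Fin (k + 1) → ℝ) j - (Fin.cons 0 p : Fin (k + 1) → ℝ) j

/-- The empirical distribution `F_n = (1/n) ∑ᵢ δ_{yᵢ}`. -/
def empiricalDist {n : ℕ} (y : Fin n → ℝ) : Measure ℝ :=
  (n : ENNReal)⁻¹ • ∑ i, Measure.dirac (y i)

/-- The base measure `α = A × F_n`. -/
def empiricalBase {n : ℕ} (A : ℝ) (y : Fin n → ℝ) : Measure ℝ :=
  ENNReal.ofReal A • empiricalDist y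

open Classical in
/-- The number `n F_n(S)` of observations that lie in `S`. -/
def obsCount {n : ℕ} (y : Fin n → ℝ) (S : Set ℝ) : ℕ :=
  (Finset.univ.filter fun i => y i ∈ S).card

/-- The density at the point `x` of the simplex of the Dirichlet distribution with parameters
`a_j > 0`. -/
def dirichletDensity {m : ℕ} (a x : Fin m → ℝ) : ℝ :=
  Real.Gamma (∑ j, a j) / (∏ j, Real.Gamma (a j)) * ∏ j, x j ^ (a j - 1)

/-- The density `h(Δp : g(F, θ), α)` at `Δp` of `g(F, θ) = (F(S₁(θ)), …, F(S_{k+1}(θ)))` when `F`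
is a Dirichlet process with base measure `α`: by definition of that process `g(F, θ)` has the
Dirichlet distribution with parameters `α(S_j(θ))`. -/
def quantileDensity {k : ℕ} (p θ : Fin k → ℝ) (α : Measure ℝ) : ℝ :=
  dirichletDensity (fun j => α.real (quantileCell θ j)) (levelIncrement p)

/-- The ratio `h(Δ : (A + n) q) / h(Δ : A q)` of two Dirichlet densities at `Δ`, as a function of the
vector `q` of cell probabilities. Both densities exist when all `q_j` are positive. When some
`q_j` vanish, the formula contains `Γ(0) / Γ(0)`, and the value is the continuous extension. -/
def dirichletRatio {m : ℕ} (A N : ℝ) (Δ : Fin m → ℝ) : (Fin m → ℝ) → ℝ :=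
  extendFrom {q : Fin m → ℝ | ∀ j, 0 < q j} fun q =>
    dirichletDensity (fun j => A * q j + N * q j) Δ / dirichletDensity (fun j => A * q j) Δ

/-- The unnormalized posterior density
`h(Δp : g(F, θ), α + n F_n) / h(Δp : g(F, θ), α) · π(θ)` of the quantiles, for `α = A × F_n`. -/
def quantileWeight {k n : ℕ} (p : Fin k → ℝ) (y : Fin n → ℝ) (prior : (Fin k → ℝ) → ℝ)
    (A : ℝ) (θ : Fin k → ℝ) : ℝ :=
  dirichletRatio A n (levelIncrement p) (fun j => (empiricalDist y).real (quantileCell θ j)) *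
    prior θ

/-- The posterior density `π(θ | y₁, …, y_n)` of the quantiles, for `α = A × F_n`. -/
def quantilePosterior {k n : ℕ} (p : Fin k → ℝ) (y : Fin n → ℝ) (prior : (Fin k → ℝ) → ℝ)
    (A : ℝ) (θ : Fin k → ℝ) : ℝ :=
  quantileWeight p y prior A θ / ∫ θ', quantileWeight p y prior A θ'

theorem obsCount_eq {n : ℕ} (hn : 0 < n) (y : Fin n → ℝ) (S : Set ℝ) :
    (obsCount y S : ℝ) = n * (empiricalDist y).real S := by
  classical
  have hn' : (n : ℝ) ≠ 0 := by exact_mod_cast hn.ne'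
  have h : (∑ i, Measure.dirac (y i)) S = ((obsCount y S : ℕ) : ENNReal) := by
    simp [Measure.finsetSum_apply, obsCount, Set.indicator_apply, Finset.sum_boole]
  simp only [empiricalDist, Measure.real, Measure.smul_apply, smul_eq_mul, h, ENNReal.toReal_mul,
    ENNReal.toReal_inv, ENNReal.toReal_natCast]
  field_simp

open Classical in
/-- The function `G(θ)` whose integrability is required of the base measure `α`, with `ᾱ = α / α(ℝ)`; the
product in the denominator runs over the set of `j` with `F_n(S_j(θ)) > 0`. -/
def quantileEnvelope {k n : ℕ} (p : Fin k → ℝ) (y : Fin n → ℝ) (prior : (Fin k → ℝ) → ℝ)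
    (α : Measure ℝ) (θ : Fin k → ℝ) : ℝ :=
  Real.Gamma (n + 1) /
      (∏ j ∈ Finset.univ.filter (fun j => 0 < (empiricalDist y).real (quantileCell θ j)),
        (α.real (quantileCell θ j) / α.real Set.univ *
          Real.Gamma (n * (empiricalDist y).real (quantileCell θ j)))) *
    (∏ j, levelIncrement p j ^ ((n : ℝ) * (empiricalDist y).real (quantileCell θ j))) * prior θ

/-- The Jeffreys likelihood `∏_j (Δp_j)^{n F_n(S_j(θ))} / ∏_j (n F_n(S_j(θ)))!`. -/
def jeffreysLikelihood {k n : ℕ} (p : Fin k → ℝ) (y : Fin n → ℝ) (θ : Fin k → ℝ) : ℝ :=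
  (∏ j, levelIncrement p j ^ obsCount y (quantileCell θ j)) /
    (∏ j, ((obsCount y (quantileCell θ j))! : ℝ))

theorem dirichletRatio_of_pos_aux {m : ℕ} {A N : ℝ} (hA : 0 < A) (hN : 0 ≤ N) {Δ q : Fin m → ℝ}
    (hΔ : ∀ j, 0 < Δ j) (hq : ∀ j, 0 < q j) :
    dirichletDensity (fun j => A * q j + N * q j) Δ / dirichletDensity (fun j => A * q j) Δ =
      Real.Gamma (∑ j, (A * q j + N * q j)) / Real.Gamma (∑ j, A * q j) *
        ∏ j, ((A + N) / A * (Real.Gamma (A * q j + 1) / Real.Gamma (A * q j + N * q j + 1)) *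
          Δ j ^ (N * q j)) := by
  have e : ∀ j, (A + N) / A * (Real.Gamma (A * q j + 1) / Real.Gamma (A * q j + N * q j + 1)) *
      Δ j ^ (N * q j) = Real.Gamma (A * q j) / Real.Gamma (A * q j + N * q j) *
        (Δ j ^ (A * q j + N * q j - 1) / Δ j ^ (A * q j - 1)) := by
    intro j
    have h1 : 0 < A * q j := mul_pos hA (hq j)
    have h2 : 0 < A * q j + N * q j := by nlinarith [mul_nonneg hN (hq j).le]
    have h3 : 0 < A + N := by linarith
    rw [Real.Gamma_add_one h1.ne', Real.Gamma_add_one h2.ne', ← Real.rpow_sub (hΔ j)]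
    have h4 := (Real.Gamma_pos_of_pos h2).ne'
    have h5 := (hq j).ne'
    rw [show A * q j + N * q j - 1 - (A * q j - 1) = N * q j by ring]
    rw [← add_mul]
    rw [← add_mul] at h4
    field_simp
  simp only [e, dirichletDensity, Finset.prod_mul_distrib, Finset.prod_div_distrib]
  have p1 : (∏ j, Real.Gamma (A * q j)) ≠ 0 :=
    Finset.prod_ne_zero_iff.2 fun j _ => (Real.Gamma_pos_of_pos (mul_pos hA (hq j))).ne'
  rw [div_mul_eq_mul_div, div_mul_eq_mul_div, div_div_div_eq]
  rw [div_mul_div_comm, div_mul_div_comm]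
  congr 1 <;> ring

/-- The continuous extension exists: at every vector of nonnegative weights with positive sum the
ratio of densities has a limit. -/
theorem dirichletRatio_tendsto {m : ℕ} {A N : ℝ} (hA : 0 < A) (hN : 0 ≤ N) {Δ q : Fin m → ℝ}
    (hΔ : ∀ j, 0 < Δ j) (hq : ∀ j, 0 ≤ q j) (hs : 0 < ∑ j, q j) :
    Tendsto (fun q : Fin m → ℝ =>
        dirichletDensity (fun j => A * q j + N * q j) Δ / dirichletDensity (fun j => A * q j) Δ)
      (𝓝[{q : Fin m → ℝ | ∀ j, 0 < q j}] q)
      (𝓝 (Real.Gamma (∑ j, (A * q j + N * q j)) / Real.Gamma (∑ j, A * q j) *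
        ∏ j, ((A + N) / A * (Real.Gamma (A * q j + 1) / Real.Gamma (A * q j + N * q j + 1)) *
          Δ j ^ (N * q j)))) := by
  have hG : ∀ x : ℝ, 0 < x → ContinuousAt Real.Gamma x := fun x hx =>
    (Real.differentiableAt_Gamma fun l => by
      have : (0 : ℝ) ≤ l := l.cast_nonneg
      linarith).continuousAt
  have hsA : 0 < ∑ j, A * q j := by rw [← Finset.mul_sum]; exact mul_pos hA hs
  have hsN : 0 < ∑ j, (A * q j + N * q j) := by
    rw [Finset.sum_add_distrib]
    have : 0 ≤ ∑ j, N * q j := Finset.sum_nonneg fun j _ => mul_nonneg hN (hq j)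
    linarith
  have hc : ContinuousAt (fun q : Fin m → ℝ =>
      Real.Gamma (∑ j, (A * q j + N * q j)) / Real.Gamma (∑ j, A * q j) *
        ∏ j, ((A + N) / A * (Real.Gamma (A * q j + 1) / Real.Gamma (A * q j + N * q j + 1)) *
          Δ j ^ (N * q j))) q := by
    refine ContinuousAt.mul (ContinuousAt.div ?_ ?_ (Real.Gamma_pos_of_pos hsA).ne') ?_
    · exact ContinuousAt.comp (f := fun q : Fin m → ℝ => ∑ j, (A * q j + N * q j))
        (hG _ hsN) (Continuous.continuousAt (by fun_prop))
    · exact ContinuousAt.comp (f := fun q : Fin m → ℝ => ∑ j, A * q j) (hG _ hsA)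
        (Continuous.continuousAt (by fun_prop))
    · refine tendsto_finsetProd _ fun j _ => ?_
      have h1 : 0 < A * q j + 1 := by nlinarith [mul_nonneg hA.le (hq j)]
      have h2 : 0 < A * q j + N * q j + 1 := by
        nlinarith [mul_nonneg hA.le (hq j), mul_nonneg hN (hq j)]
      refine ContinuousAt.mul (ContinuousAt.mul continuousAt_const
        (ContinuousAt.div ?_ ?_ (Real.Gamma_pos_of_pos h2).ne')) ?_
      · exact ContinuousAt.comp (f := fun q : Fin m → ℝ => A * q j + 1) (hG _ h1)
          (Continuous.continuousAt (by fun_prop))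
      · exact ContinuousAt.comp (f := fun q : Fin m → ℝ => A * q j + N * q j + 1)
          (hG _ h2) (Continuous.continuousAt (by fun_prop))
      · exact ContinuousAt.rpow continuousAt_const (Continuous.continuousAt (by fun_prop)) (Or.inl (hΔ j).ne')
  refine (hc.tendsto.mono_left nhdsWithin_le_nhds).congr' ?_
  filter_upwards [self_mem_nhdsWithin] with q' hq'
  exact (dirichletRatio_of_pos_aux hA hN hΔ hq').symm

/-- When all cell probabilities are positive, no extension is involved: the value is the ratio of
the two densities. -/
theorem dirichletRatio_of_pos {m : ℕ} {A N : ℝ} (hA : 0 < A) (hN : 0 ≤ N) {Δ q : Fin m → ℝ}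
    (hΔ : ∀ j, 0 < Δ j) (hq : ∀ j, 0 < q j) (hs : 0 < ∑ j, q j) :
    dirichletRatio A N Δ q =
      dirichletDensity (fun j => A * q j + N * q j) Δ /
        dirichletDensity (fun j => A * q j) Δ := by
  rw [dirichletRatio_of_pos_aux hA hN hΔ hq]
  exact extendFrom_eq (subset_closure hq)
    (dirichletRatio_tendsto hA hN hΔ (fun j => (hq j).le) hs)

/-- Where all cells contain observations, the posterior weight is literally
`h(Δp : g(F, θ), α + n F_n) / h(Δp : g(F, θ), α) · π(θ)` with `α = A × F_n`. -/
theorem quantileWeight_of_pos {k n : ℕ} {p : Fin k → ℝ} {y : Fin n → ℝ}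
    (prior : (Fin k → ℝ) → ℝ) {A : ℝ} (hA : 0 < A) (hn : 0 < n) {θ : Fin k → ℝ}
    (hΔ : ∀ j, 0 < levelIncrement p j)
    (hθ : ∀ j, 0 < (empiricalDist y).real (quantileCell θ j)) :
    quantileWeight p y prior A θ =
      quantileDensity p θ (empiricalBase A y + (n : ENNReal) • empiricalDist y) /
        quantileDensity p θ (empiricalBase A y) * prior θ := by
  have hfin : ∀ S, (empiricalDist y) S ≠ ⊤ := by
    intro S
    have : (n : ENNReal) ≠ 0 := by exact_mod_cast hn.ne'
    simp only [empiricalDist, Measure.smul_apply, smul_eq_mul]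
    exact ENNReal.mul_ne_top (ENNReal.inv_ne_top.2 this) (measure_ne_top _ _)
  unfold quantileWeight
  rw [dirichletRatio_of_pos hA n.cast_nonneg hΔ hθ
    (Finset.sum_pos (fun j _ => hθ j) Finset.univ_nonempty)]
  have e1 : ∀ S, (empiricalBase A y).real S = A * (empiricalDist y).real S := by
    intro S
    simp [empiricalBase, Measure.real, ENNReal.toReal_ofReal hA.le]
  have e2 : ∀ S, (empiricalBase A y + (n : ENNReal) • empiricalDist y).real S =
      A * (empiricalDist y).real S + n * (empiricalDist y).real S := by
    intro S
    rw [← e1]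
    simp only [Measure.real, Measure.add_apply, Measure.smul_apply, smul_eq_mul]
    rw [ENNReal.toReal_add, ENNReal.toReal_mul, ENNReal.toReal_natCast]
    · simp only [empiricalBase, Measure.smul_apply, smul_eq_mul]
      exact ENNReal.mul_ne_top ENNReal.ofReal_ne_top (hfin S)
    · exact ENNReal.mul_ne_top (ENNReal.natCast_ne_top n) (hfin S)
  simp only [quantileDensity, e1, e2]

end

/-! All integrands depend on `θ` only through the prior and the vector of cell counts, which takes
finitely many values. Hence they are bounded multiples of an integrable prior, and pointwise limits
in `A` are automatically dominated. The identity `Γ(x + 1) = x Γ(x)` turns `Γ(Aq) / Γ((A + n)q)`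
into `(A + n) / A · Γ(Aq + 1) / Γ((A + n)q + 1)`, which is regular at `q = 0`; this gives the
continuous extension. For monotone `θ` the cells partition the line, so `∑ q = 1` and the weight
splits (`quantileWeight_eq`) into `ratioConstant`, of order `A ^ (-k)` but free of `θ`, and
`countLikelihood`, continuous down to `A = 0`, where it is the Jeffreys likelihood. Normalization
cancels the first factor; dominated convergence handles the second. -/

/-! ### Cell counts and integrals of functions of them -/

/-- The numbers of observations in the cells cut by `θ`. -/
noncomputable def cellCounts {k n : ℕ} (y : Fin n → ℝ) (θ : Fin k → ℝ) (j : Fin (k + 1)) : ℕ :=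
  obsCount y (quantileCell θ j)

theorem obsCount_le {n : ℕ} (y : Fin n → ℝ) (S : Set ℝ) : obsCount y S ≤ n := by
  classical
  simpa [obsCount] using Finset.card_filter_le (Finset.univ : Finset (Fin n)) fun i => y i ∈ S

theorem empiricalDist_real_eq {n : ℕ} (hn : 0 < n) (y : Fin n → ℝ) (S : Set ℝ) :
    (empiricalDist y).real S = (obsCount y S : ℝ) / n := by
  have : (n : ℝ) ≠ 0 := by exact_mod_cast hn.ne'
  rw [obsCount_eq hn]
  field_simp

theorem measurableSet_mem_quantileCell {k : ℕ} (t : ℝ) (j : Fin (k + 1)) :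
    MeasurableSet {θ : Fin k → ℝ | t ∈ quantileCell θ j} := by
  have h : {θ : Fin k → ℝ | t ∈ quantileCell θ j} =
      (⋂ i : Fin k, ⋂ _ : i.succ = j, {θ | θ i < t}) ∩
        ⋂ i : Fin k, ⋂ _ : i.castSucc = j, {θ | t ≤ θ i} := by
    ext θ
    simp [quantileCell]
  rw [h]
  exact (MeasurableSet.iInter fun i => MeasurableSet.iInter fun _ =>
      measurableSet_lt (measurable_pi_apply i) measurable_const).inter
    (MeasurableSet.iInter fun i => MeasurableSet.iInter fun _ =>
      measurableSet_le measurable_const (measurable_pi_apply i))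

theorem measurable_cellCounts {k n : ℕ} (y : Fin n → ℝ) :
    Measurable (cellCounts (k := k) y) := by
  classical
  refine measurable_pi_lambda _ fun j => ?_
  simp only [cellCounts, obsCount, Finset.card_filter]
  exact Finset.measurable_fun_sum _ fun i _ =>
    Measurable.ite (measurableSet_mem_quantileCell (y i) j) measurable_const measurable_const

theorem exists_fin_eq_cellCounts {k n : ℕ} (y : Fin n → ℝ) (θ : Fin k → ℝ) :
    ∃ v : Fin (k + 1) → Fin (n + 1), cellCounts y θ = fun j => (v j : ℕ) :=
  ⟨fun j => ⟨cellCounts y θ j, Nat.lt_succ_of_le (obsCount_le y _)⟩, rfl⟩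

/-- A function of the cell counts takes finitely many values, so its product with an integrable
function is integrable. -/
theorem integrable_comp_cellCounts_mul {k n : ℕ} (y : Fin n → ℝ) {f : (Fin k → ℝ) → ℝ}
    (hf : Integrable f) (Φ : (Fin (k + 1) → ℕ) → ℝ) :
    Integrable fun θ => Φ (cellCounts y θ) * f θ := by
  -- Summing over every conceivable count vector gives one bound valid for all `θ`.
  refine hf.bdd_mul (c := ∑ v : Fin (k + 1) → Fin (n + 1), |Φ fun j => v j|)
    ((measurable_of_countable Φ).comp (measurable_cellCounts y)).aestronglyMeasurable
    (Eventually.of_forall fun θ => ?_)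
  obtain ⟨v, hv⟩ := exists_fin_eq_cellCounts y θ
  rw [hv, Real.norm_eq_abs]
  exact Finset.single_le_sum (f := fun v : Fin (k + 1) → Fin (n + 1) => |Φ fun j => v j|)
    (fun _ _ => abs_nonneg _) (Finset.mem_univ v)

/-- With finitely many count vectors, pointwise convergence gives `|Φ A| ≤ |Ψ| + 1` on all of them
at once, eventually along `l`; this supplies the dominating function. -/
theorem tendsto_integral_comp_cellCounts_mul {k n : ℕ} (y : Fin n → ℝ) {f : (Fin k → ℝ) → ℝ}
    (hf : Integrable f) {l : Filter ℝ} [l.IsCountablyGenerated]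
    {Φ : ℝ → (Fin (k + 1) → ℕ) → ℝ} {Ψ : (Fin (k + 1) → ℕ) → ℝ}
    (h : ∀ c, Tendsto (fun A => Φ A c) l (𝓝 (Ψ c))) :
    Tendsto (fun A => ∫ θ, Φ A (cellCounts y θ) * f θ) l
      (𝓝 (∫ θ, Ψ (cellCounts y θ) * f θ)) := by
  have hev : ∀ᶠ A in l, ∀ v : Fin (k + 1) → Fin (n + 1),
      |Φ A fun j => v j| ≤ |Ψ fun j => v j| + 1 :=
    eventually_all.2 fun v => ((h _).abs.eventually_lt_const (lt_add_one _)).mono fun _ => le_of_lt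
  refine tendsto_integral_filter_of_dominated_convergence
    (fun θ => (|Ψ (cellCounts y θ)| + 1) * |f θ|)
    (Eventually.of_forall fun A => (integrable_comp_cellCounts_mul y hf (Φ A)).1)
    (hev.mono fun A hA => Eventually.of_forall fun θ => ?_)
    (integrable_comp_cellCounts_mul y hf.abs fun c => |Ψ c| + 1)
    (Eventually.of_forall fun θ => (h _).mul_const _)
  obtain ⟨v, hv⟩ := exists_fin_eq_cellCounts y θ
  rw [hv, norm_mul, Real.norm_eq_abs, Real.norm_eq_abs]
  exact mul_le_mul_of_nonneg_right (hA v) (abs_nonneg _)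

/-! ### Geometry of levels and cells -/

theorem levelIncrement_pos {k : ℕ} {p : Fin k → ℝ} (hp_mono : StrictMono p)
    (hp_pos : ∀ i, 0 < p i) (hp_lt : ∀ i, p i < 1) (j : Fin (k + 1)) :
    0 < levelIncrement p j := by
  unfold levelIncrement
  rw [sub_pos]
  induction j using Fin.cases with
  | zero =>
    rw [Fin.cons_zero]
    -- Index `0` is also the last one when `k = 0`. Every entry of `Fin.snoc p 1` is positive, so
    -- both cases work.
    induction (0 : Fin (k + 1)) using Fin.lastCases with
    | last => simp
    | cast i => simpa using hp_pos i
  | succ i =>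
    rw [Fin.cons_succ]
    generalize hj : i.succ = j
    induction j using Fin.lastCases with
    | last => simpa using hp_lt i
    | cast l =>
      rw [Fin.snoc_castSucc]
      refine hp_mono (Fin.lt_def.2 ?_)
      have := congrArg Fin.val hj
      simp at this
      omega

/-- The cells cover the line, also when `θ` is not monotone. -/
theorem exists_mem_quantileCell {k : ℕ} (θ : Fin k → ℝ) (t : ℝ) :
    ∃ j, t ∈ quantileCell θ j := by
  classical
  by_cases h : ∃ i, t ≤ θ i
  -- For the first entry at or above `t`, minimality puts the preceding entry strictly below `t`.
  · obtain ⟨i, hi, hmin⟩ := WellFounded.has_min (wellFounded_lt (α := Fin k)) {i | t ≤ θ i} h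
    refine ⟨i.castSucc, fun l hl => ?_, fun l hl => ?_⟩
    · by_contra hc
      refine hmin l (not_lt.1 hc) (Fin.lt_def.2 ?_)
      have := congrArg Fin.val hl
      simp at this
      omega
    · rwa [Fin.castSucc_injective _ hl]
  · push Not at h
    exact ⟨Fin.last k, fun l _ => h l, fun l hl => absurd hl (Fin.castSucc_lt_last l).ne⟩

/-- If `i < j`, the upper end of cell `i` is at most the lower end of cell `j`, which would force `t
< t`. -/
theorem not_lt_of_mem_quantileCell {k : ℕ} {θ : Fin k → ℝ} (hθ : Monotone θ) {t : ℝ}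
    {i j : Fin (k + 1)} (hi : t ∈ quantileCell θ i) (hj : t ∈ quantileCell θ j) : ¬ i < j := by
  intro hij
  have h1 := hi.2 ⟨i, by have := j.isLt; have := Fin.lt_def.1 hij; omega⟩ (Fin.ext rfl)
  have h2 := hj.1 ⟨j - 1, by have := j.isLt; have := Fin.lt_def.1 hij; omega⟩
    (Fin.ext (by have := Fin.lt_def.1 hij; simp; omega))
  exact absurd (h2.trans_le h1)
    (not_lt.2 (hθ (Fin.le_def.2 (by have := Fin.lt_def.1 hij; simp; omega))))

/-- Double counting: each observation lies in exactly one cell. Monotonicity matters, since the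
cells of an unordered `θ` can overlap. -/
theorem sum_cellCounts {k n : ℕ} (y : Fin n → ℝ) {θ : Fin k → ℝ} (hθ : Monotone θ) :
    ∑ j, cellCounts y θ j = n := by
  classical
  simp only [cellCounts, obsCount, Finset.card_filter]
  rw [Finset.sum_comm]
  have : ∀ i, (∑ j, if y i ∈ quantileCell θ j then 1 else 0) = 1 := fun i => by
    obtain ⟨j, hj⟩ := exists_mem_quantileCell θ (y i)
    rw [Finset.sum_eq_single j (fun l _ hl => if_neg fun hm => ?_) (by simp), if_pos hj]
    exact hl (le_antisymm (not_lt.1 (not_lt_of_mem_quantileCell hθ hj hm))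
      (not_lt.1 (not_lt_of_mem_quantileCell hθ hm hj)))
  simp [this]

/-! ### The posterior weight as a function of the counts -/

theorem mem_closure_setOf_forall_pos {m : ℕ} {q : Fin m → ℝ} (hq : ∀ j, 0 ≤ q j) :
    q ∈ closure {q : Fin m → ℝ | ∀ j, 0 < q j} := by
  have : {q : Fin m → ℝ | ∀ j, 0 < q j} = Set.univ.pi fun _ => Set.Ioi 0 := by
    ext; simp
  rw [this, closure_pi_set]
  simpa [closure_Ioi, Pi.le_def] using hq

theorem dirichletRatio_of_nonneg {m : ℕ} {A N : ℝ} (hA : 0 < A) (hN : 0 ≤ N) {Δ q : Fin m → ℝ}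
    (hΔ : ∀ j, 0 < Δ j) (hq : ∀ j, 0 ≤ q j) (hs : 0 < ∑ j, q j) :
    dirichletRatio A N Δ q =
      Real.Gamma (∑ j, (A * q j + N * q j)) / Real.Gamma (∑ j, A * q j) *
        ∏ j, ((A + N) / A * (Real.Gamma (A * q j + 1) / Real.Gamma (A * q j + N * q j + 1)) *
          Δ j ^ (N * q j)) :=
  -- Membership in the closure makes the limit unique, hence equal to the value of `extendFrom`.
  extendFrom_eq (mem_closure_setOf_forall_pos hq) (dirichletRatio_tendsto hA hN hΔ hq hs)

/-- The factor of the density ratio that depends on the cell counts `c`, for `A ≥ 0`. -/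
noncomputable def countLikelihood {m : ℕ} (n : ℕ) (Δ : Fin m → ℝ) (A : ℝ) (c : Fin m → ℕ) : ℝ :=
  ∏ j, (Real.Gamma (A * (c j / n) + 1) / Real.Gamma (A * (c j / n) + c j + 1) * Δ j ^ c j)

/-- The factor of the density ratio that does not depend on the cell counts. -/
noncomputable def ratioConstant (m n : ℕ) (A : ℝ) : ℝ :=
  Real.Gamma (A + n) / Real.Gamma A * ((A + n) / A) ^ m

theorem ratioConstant_pos (m n : ℕ) {A : ℝ} (hA : 0 < A) : 0 < ratioConstant m n A := by
  have h : 0 < A + n := by positivity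
  exact mul_pos (div_pos (Real.Gamma_pos_of_pos h) (Real.Gamma_pos_of_pos hA))
    (pow_pos (div_pos h hA) m)

theorem countLikelihood_pos {m : ℕ} (n : ℕ) {Δ : Fin m → ℝ} (hΔ : ∀ j, 0 < Δ j) {A : ℝ}
    (hA : 0 ≤ A) (c : Fin m → ℕ) : 0 < countLikelihood n Δ A c :=
  Finset.prod_pos fun j _ => mul_pos (div_pos (Real.Gamma_pos_of_pos (by positivity))
    (Real.Gamma_pos_of_pos (by positivity))) (pow_pos (hΔ j) _)

theorem countLikelihood_zero {m : ℕ} (n : ℕ) (Δ : Fin m → ℝ) (c : Fin m → ℕ) :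
    countLikelihood n Δ 0 c = (∏ j, Δ j ^ c j) / ∏ j, ((c j)! : ℝ) := by
  rw [countLikelihood, ← Finset.prod_div_distrib]
  refine Finset.prod_congr rfl fun j _ => ?_
  rw [zero_mul, zero_add, zero_add, Real.Gamma_one, Real.Gamma_nat_eq_factorial]
  ring

/-- The shift by one keeps the Gamma arguments away from the poles at `A = 0`, even for empty cells.
-/
theorem tendsto_countLikelihood {m : ℕ} (n : ℕ) (Δ : Fin m → ℝ) (c : Fin m → ℕ) :
    Tendsto (fun A => countLikelihood n Δ A c) (𝓝[>] 0) (𝓝 (countLikelihood n Δ 0 c)) := by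
  have hG : ∀ a b : ℝ, 0 < b → ContinuousAt (fun A : ℝ => Real.Gamma (A * a + b)) 0 :=
    fun a b hb => by
      have h : ContinuousAt Real.Gamma (0 * a + b) := by
        refine (Real.differentiableAt_Gamma fun l => ?_).continuousAt
        have : (0 : ℝ) ≤ l := l.cast_nonneg
        linarith
      exact ContinuousAt.comp (f := fun A : ℝ => A * a + b) h
        (Continuous.continuousAt (by fun_prop))
  have hc : ContinuousAt (fun A => countLikelihood n Δ A c) 0 := by
    refine tendsto_finsetProd _ fun j _ => ?_
    simp only [add_assoc]
    refine ((hG _ 1 one_pos).div (hG _ _ (by positivity)) ?_).mul continuousAt_const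
    exact (Real.Gamma_pos_of_pos (by positivity)).ne'
  exact hc.tendsto.mono_left nhdsWithin_le_nhds

theorem jeffreysLikelihood_eq {k n : ℕ} (p : Fin k → ℝ) (y : Fin n → ℝ) (θ : Fin k → ℝ) :
    jeffreysLikelihood p y θ = countLikelihood n (levelIncrement p) 0 (cellCounts y θ) :=
  (countLikelihood_zero n _ _).symm

/-- Off the monotone `θ` the prior kills both sides; on them the cell masses sum to one, so the
leading Gamma quotient does not involve `θ`. -/
theorem quantileWeight_eq {k n : ℕ} (hn : 0 < n) {p : Fin k → ℝ}
    (hΔ : ∀ j, 0 < levelIncrement p j) (y : Fin n → ℝ) {prior : (Fin k → ℝ) → ℝ}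
    (hsupp : ∀ θ, ¬ Monotone θ → prior θ = 0) {A : ℝ} (hA : 0 < A) (θ : Fin k → ℝ) :
    quantileWeight p y prior A θ = ratioConstant (k + 1) n A *
      (countLikelihood n (levelIncrement p) A (cellCounts y θ) * prior θ) := by
  by_cases hθ : Monotone θ
  swap
  · simp [quantileWeight, hsupp θ hθ]
  have hn' : (n : ℝ) ≠ 0 := by exact_mod_cast hn.ne'
  have hq : ∀ j, (empiricalDist y).real (quantileCell θ j) = (cellCounts y θ j : ℝ) / n :=
    fun j => empiricalDist_real_eq hn y _
  have hs : ∑ j, (cellCounts y θ j : ℝ) / n = 1 := by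
    rw [← Finset.sum_div, ← Nat.cast_sum, sum_cellCounts y hθ, div_self hn']
  have hN : ∀ j, (n : ℝ) * ((cellCounts y θ j : ℝ) / n) = cellCounts y θ j :=
    fun j => mul_div_cancel₀ _ hn'
  have hsA : ∑ j, A * ((cellCounts y θ j : ℝ) / n) = A := by rw [← Finset.mul_sum, hs, mul_one]
  have hsN : ∑ j, (A * ((cellCounts y θ j : ℝ) / n) + n * ((cellCounts y θ j : ℝ) / n)) = A + n := by
    rw [Finset.sum_add_distrib, hsA, ← Finset.mul_sum, hs, mul_one]
  unfold quantileWeight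
  simp only [hq]
  rw [dirichletRatio_of_nonneg hA n.cast_nonneg hΔ (fun j => by positivity) (by rw [hs]; exact one_pos),
    hsN, hsA]
  simp only [hN, Real.rpow_natCast, ratioConstant, countLikelihood, mul_assoc,
    Finset.prod_mul_distrib, Finset.prod_const, Finset.card_univ, Fintype.card_fin]

theorem quantileEnvelope_eq_comp_cellCounts {k n : ℕ} (hn : 0 < n) (p : Fin k → ℝ)
    (y : Fin n → ℝ) {A : ℝ} (hA : 0 < A) :
    ∃ Φ : (Fin (k + 1) → ℕ) → ℝ, ∀ (prior : (Fin k → ℝ) → ℝ) (θ : Fin k → ℝ),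
      quantileEnvelope p y prior (empiricalBase A y) θ = Φ (cellCounts y θ) * prior θ := by
  classical
  have e : ∀ S, (empiricalBase A y).real S = A * (empiricalDist y).real S := fun S => by
    simp [empiricalBase, Measure.real, ENNReal.toReal_ofReal hA.le]
  refine ⟨fun c => Real.Gamma (n + 1) /
      (∏ j ∈ Finset.univ.filter (fun j => 0 < (c j : ℝ) / n),
        (A * ((c j : ℝ) / n) / (empiricalBase A y).real Set.univ *
          Real.Gamma (n * ((c j : ℝ) / n)))) *
    (∏ j, levelIncrement p j ^ ((n : ℝ) * ((c j : ℝ) / n))), fun prior θ => ?_⟩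
  simp only [quantileEnvelope, e, empiricalDist_real_eq hn, cellCounts]
  congr!

/-! ### Positive normalizers and the limit -/

theorem integral_mul_pos_of_pos {X : Type*} [MeasurableSpace X] {μ : Measure X} {g f : X → ℝ}
    (hg : ∀ x, 0 < g x) (hf : ∀ x, 0 ≤ f x) (hfi : Integrable f μ)
    (hgf : Integrable (fun x => g x * f x) μ) (h : 0 < ∫ x, f x ∂μ) :
    0 < ∫ x, g x * f x ∂μ := by
  rw [integral_pos_iff_support_of_nonneg hf hfi] at h
  rw [integral_pos_iff_support_of_nonneg (fun x => mul_nonneg (hg x).le (hf x)) hgf]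
  have e : Function.support (fun x => g x * f x) = Function.support f := by
    ext x
    simp [(hg x).ne']
  rwa [e]

theorem mainTheorem5 (k n : ℕ) (hn : 0 < n) (p : Fin k → ℝ) (hp_mono : StrictMono p)
    (hp_pos : ∀ i, 0 < p i) (hp_lt : ∀ i, p i < 1) (y : Fin n → ℝ)
    (prior : (Fin k → ℝ) → ℝ) (hprior_meas : Measurable prior) (hprior_nonneg : ∀ θ, 0 ≤ prior θ)
    (hprior_supp : ∀ θ, ¬ Monotone θ → prior θ = 0) (hprior_int : ∫ θ, prior θ = 1) :
    (∀ A : ℝ, 0 < A → Integrable (quantileEnvelope p y prior (empiricalBase A y))) ∧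
    (∀ A : ℝ, 0 < A → Integrable (quantileWeight p y prior A) ∧
      0 < ∫ θ, quantileWeight p y prior A θ) ∧
    ∃ z : ℝ, 0 < z ∧ Integrable (fun θ => jeffreysLikelihood p y θ * prior θ) ∧
      z = ∫ θ, jeffreysLikelihood p y θ * prior θ ∧
      ∀ θ : Fin k → ℝ, Tendsto (fun A : ℝ => quantilePosterior p y prior A θ) (𝓝[>] 0)
        (𝓝 (1 / z * (jeffreysLikelihood p y θ * prior θ))) := by
  have hΔ := levelIncrement_pos hp_mono hp_pos hp_lt
  -- A non-integrable function has integral `0` by convention, which contradicts total mass `1`.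
  have hint : Integrable prior := by
    by_contra h
    rw [integral_undef h] at hprior_int
    exact zero_ne_one hprior_int
  have hw : ∀ A : ℝ, 0 < A → quantileWeight p y prior A = fun θ => ratioConstant (k + 1) n A *
      (countLikelihood n (levelIncrement p) A (cellCounts y θ) * prior θ) :=
    fun A hA => funext fun θ => quantileWeight_eq hn hΔ y hprior_supp hA θ
  have hLint : ∀ A : ℝ, Integrable fun θ =>
      countLikelihood n (levelIncrement p) A (cellCounts y θ) * prior θ :=
    fun A => integrable_comp_cellCounts_mul y hint _
  have hLpos : ∀ A : ℝ, 0 ≤ A →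
      0 < ∫ θ, countLikelihood n (levelIncrement p) A (cellCounts y θ) * prior θ :=
    fun A hA => integral_mul_pos_of_pos (fun θ => countLikelihood_pos n hΔ hA _) hprior_nonneg hint
      (hLint A) (hprior_int ▸ one_pos)
  refine ⟨fun A hA => ?_, fun A hA => ?_, _, ?_, ?_, rfl, fun θ => ?_⟩
  · obtain ⟨Φ, hΦ⟩ := quantileEnvelope_eq_comp_cellCounts hn p y hA
    rw [funext (hΦ prior)]
    exact integrable_comp_cellCounts_mul y hint Φ
  · rw [hw A hA]
    refine ⟨(hLint A).const_mul _, ?_⟩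
    rw [integral_const_mul]
    exact mul_pos (ratioConstant_pos _ _ hA) (hLpos A hA.le)
  · simpa only [jeffreysLikelihood_eq] using hLpos 0 le_rfl
  · simpa only [jeffreysLikelihood_eq] using hLint 0
  · simp only [jeffreysLikelihood_eq]
    rw [one_div_mul_eq_div]
    refine Tendsto.congr' ?_ (((tendsto_countLikelihood n (levelIncrement p) _).mul_const _).div
      (tendsto_integral_comp_cellCounts_mul y hint (tendsto_countLikelihood n (levelIncrement p)))
      (hLpos 0 le_rfl).ne')
    -- For `A > 0` the constant is nonzero and cancels between the weight and its integral.
    filter_upwards [self_mem_nhdsWithin] with A hA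
    rw [quantilePosterior, hw A hA, integral_const_mul,
      mul_div_mul_left _ _ (ratioConstant_pos _ _ hA).ne']
    rfl
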